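/- An ai-semiring is an algebra $(S,+,\cdot)$ such that $(S,+)$ is a commutative idempotent semigroup, $(S,\cdot)$ is a semigroup, and both distributive laws $(x+y)z\approx xz+yz$ and $x(y+z)\approx xy+xz$ hold. Let $S_{(4,12)}$ be the ai-semiring on $\{1,2,3,4\}$ in which $a+a=a$, $a+b=1$ for all $a\neq b$, and $2\cdot 4=2$, $4\cdot 3=3$, $4\cdot 4=4$, all other products being $1$. Let $\mathsf V(S_{(4,12)})$ be the variety generated by $S_{(4,12)}$, that is, the class of all homomorphic images of subalgebras of direct powers of $S_{(4,12)}$. **Proposition.** An ai-semiring belongs to $\mathsf V(S_{(4,12)})$ if and only if it satisfies the identities \begin{align*} (1)\;& x^2\approx x^4; & (2)\;& x^2y^2\approx (xy)^2; & (3)\;& x^2y^2\approx y^2x^2;\\ (4)\;& x^2\approx x^2+x; & (5)\;& x^2y^2\approx x^2y^2+x^2; & (6)\;& x+yx\approx y^2x;\\ (7)\;& x+xy\approx xy^2; & (8)\;& x+y^2\approx x+y^2+y^2x^2; & (9)\;& xy^2+z\approx xy^2+zy;\\ (10)\;& x^2y+z\approx x^2y+xz; \end{align*} \begin{align*} (11)\;&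 x_1^2x_2+x_3x_4^2\approx x_1^2x_2^2x_3^2x_4^2;\\ (12)\;& x_1x_2+y_1y_2\approx x_1x_2+y_1y_2+x_1y_2;\\ (13)\;& x_1x_2+x_3x_2x_4\approx x_1x_2+x_3x_2x_4+x_1;\\ (14)\;& x_1x_2+x_3x_1x_4\approx x_1x_2+x_3x_1x_4+x_2;\\ (15)\;& x_1x_2+y_1x_2y_2\approx x_1x_2+y_1x_2y_2+x_1x_2y_2^2;\\ (16)\;& x_1x_2+y_1x_1y_2\approx x_1x_2+y_1x_1y_2+y_1^2x_1x_2;\\ (17)\;& x_1x_2+x_3x_2x_4+x_5\approx x_1x_2+x_3x_2x_4+x_5x_2;\\ (18)\;& x_1x_2+x_3x_1x_4+x_5\approx x_1x_2+x_3x_1x_4+x_1x_5;\\ (19)\;& x_1x_2+y_1x_1y_2x_1y_3\approx x_1x_2+y_1x_1y_2x_1y_3+x_1^2x_2;\\ (20)\;& x_1x_2+y_1x_2y_2x_2y_3\approx x_1x_2+y_1x_2y_2x_2y_3+x_1x_2^2, \end{align*} where any of the following variables may be empty (that is, any set of them may be deleted throughout the identity, and each identity obtained in this way is included in the list): $x_2,x_3$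 in (11); $x_1,y_1$ in (15); $x_2,y_2$ in (16); $x_2,y_1,y_2,y_3$ in (19); $x_1,y_1,y_2,y_3$ in (20). Hence $S_{(4,12)}$ is finitely based: there is a finite set of identities that hold in $S_{(4,12)}$ from which, together with the identities defining ai-semirings, every identity that holds in $S_{(4,12)}$ is derivable in equational logic. -/

import Mathlib

universe u v

/-- An additively idempotent semiring: the addition is a commutative idempotent semigroup, the
multiplication is a semigroup, and multiplication distributes over addition on both sides.
Neither a zero nor a unit is required. -/
class AISemiring (S : Type u) extends AddCommSemigroup S, Semigroup S, Distrib S where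
  add_idem : ∀ a : S, a + a = a

/-- Direct powers of ai-semirings, with componentwise operations. -/
instance AISemiring.power (I : Type v) (S : Type u) [AISemiring S] : AISemiring (I → S) where
  add f g := fun i => f i + g i
  mul f g := fun i => f i * g i
  add_assoc _ _ _ := funext fun _ => add_assoc _ _ _
  add_comm _ _ := funext fun _ => add_comm _ _
  mul_assoc _ _ _ := funext fun _ => mul_assoc _ _ _
  left_distrib _ _ _ := funext fun _ => left_distrib _ _ _
  right_distrib _ _ _ := funext fun _ => right_distrib _ _ _
  add_idem _ := funext fun _ => AISemiring.add_idem _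

/-- Homomorphisms of ai-semirings. -/
structure IsAIHom {A : Type u} {B : Type v} [AISemiring A] [AISemiring B] (f : A → B) : Prop where
  map_add : ∀ a b : A, f (a + b) = f a + f b
  map_mul : ∀ a b : A, f (a * b) = f a * f b

/-- `A` belongs to the variety generated by `S`: it is a homomorphic image of an ai-semiring `B`
that embeds into a direct power of `S` (Tarski's `HSP`). -/
def InVariety (S : Type v) [AISemiring S] (A : Type u) [AISemiring A] : Prop :=
  ∃ (I : Type u) (B : Type (max u v)) (_ : AISemiring B) (e : B → (I → S)) (f : B → A),
    IsAIHom e ∧ Function.Injective e ∧ IsAIHom f ∧ Function.Surjective f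

/-- Ai-semiring terms over the countably infinite set of variables indexed by `ℕ`. -/
inductive AITerm : Type
  | var : ℕ → AITerm
  | add : AITerm → AITerm → AITerm
  | mul : AITerm → AITerm → AITerm
  deriving DecidableEq

namespace AITerm

instance : Add AITerm := ⟨AITerm.add⟩

instance : Mul AITerm := ⟨AITerm.mul⟩

/-- The value of a term under an assignment of the variables. -/
def eval {A : Type u} [AISemiring A] (φ : ℕ → A) : AITerm → A
  | var n => φ n
  | add s t => s.eval φ + t.eval φ
  | mul s t => s.eval φ * t.eval φ

/-- Simultaneous substitution of terms for variables. -/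
def subst (σ : ℕ → AITerm) : AITerm → AITerm
  | var n => σ n
  | add s t => s.subst σ + t.subst σ
  | mul s t => s.subst σ * t.subst σ

/-- Delete from a term all occurrences of the variables in `F`, that is, replace these variables by
the empty word. The value `none` stands for the empty word; a sum with an empty summand
is not an ai-semiring term, so it is given no value other than `none`. -/
def erase (F : Finset ℕ) : AITerm → Option AITerm
  | var n => if n ∈ F then none else some (var n)
  | add s t =>
    match s.erase F, t.erase F with
    | some s', some t' => some (s' + t')
    | _, _ => none
  | mul s t =>
    match s.erase F, t.erase F with
    | some s', some t' => some (s' * t')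
    | some s', none => some s'
    | none, some t' => some t'
    | none, none => none

end AITerm

/-- An ai-semiring identity. -/
structure AIIdentity : Type where
  lhs : AITerm
  rhs : AITerm

infix:50 " ≐ " => AIIdentity.mk

/-- `A` satisfies the identity `e`. -/
def Satisfies (A : Type u) [AISemiring A] (e : AIIdentity) : Prop :=
  ∀ φ : ℕ → A, e.lhs.eval φ = e.rhs.eval φ

/-- `Derivable E s t`: the identity between `s` and `t` is derivable, in equational logic,
from the identities in `E` together with the identities that define ai-semirings. -/
inductive Derivable (E : Set AIIdentity) : AITerm → AITerm → Prop
  | refl (s : AITerm) : Derivable E s s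
  | symm {s t : AITerm} : Derivable E s t → Derivable E t s
  | trans {r s t : AITerm} : Derivable E r s → Derivable E s t → Derivable E r t
  | add_congr {s s' t t' : AITerm} :
      Derivable E s s' → Derivable E t t' → Derivable E (s + t) (s' + t')
  | mul_congr {s s' t t' : AITerm} :
      Derivable E s s' → Derivable E t t' → Derivable E (s * t) (s' * t')
  | instance_of {e : AIIdentity} (he : e ∈ E) (σ : ℕ → AITerm) :
      Derivable E (e.lhs.subst σ) (e.rhs.subst σ)
  | add_assoc (r s t : AITerm) : Derivable E (r + s + t) (r + (s + t))
  | add_comm (s t : AITerm) : Derivable E (s + t) (t + s)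
  | add_idem (s : AITerm) : Derivable E (s + s) s
  | mul_assoc (r s t : AITerm) : Derivable E (r * s * t) (r * (s * t))
  | left_distrib (r s t : AITerm) : Derivable E (r * (s + t)) (r * s + r * t)
  | right_distrib (r s t : AITerm) : Derivable E ((r + s) * t) (r * t + s * t)

/-- `E` is an equational basis of `S`: its members hold in `S`, and every identity of `S`
is derivable from `E`. -/
def IsEquationalBasis (E : Set AIIdentity) (S : Type u) [AISemiring S] : Prop :=
  (∀ e ∈ E, Satisfies S e) ∧ ∀ e : AIIdentity, Satisfies S e → Derivable E e.lhs e.rhs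

/-- `S` is finitely based: its identities are derivable from finitely many of them. -/
def FinitelyBased (S : Type u) [AISemiring S] : Prop :=
  ∃ E : Set AIIdentity, E.Finite ∧ IsEquationalBasis E S

/-- The four-element carrier `{1, 2, 3, 4}`. -/
inductive S412 : Type
  | e1 | e2 | e3 | e4
  deriving DecidableEq

namespace S412

instance : Fintype S412 := ⟨{e1, e2, e3, e4}, fun a => by cases a <;> decide⟩

/-- Addition: `1` is the top element, and `2`, `3`, `4` are pairwise incomparable below it. -/
protected def add (a b : S412) : S412 := if a = b then a else e1

/-- Multiplication: `2 * 4 = 2`, `4 * 3 = 3`, `4 * 4 = 4`, and all other products are `1`. -/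
protected def mul : S412 → S412 → S412
  | e2, e4 => e2
  | e4, e3 => e3
  | e4, e4 => e4
  | _, _ => e1

instance : AISemiring S412 where
  add := S412.add
  mul := S412.mul
  add_assoc := by decide
  add_comm := by decide
  mul_assoc := by decide
  left_distrib := by decide
  right_distrib := by decide
  add_idem := by decide

end S412

/-- All the identities obtained from `e` by letting some (possibly none, possibly all) of the
variables with index in `M` be empty. -/
def maybeEmpty (M : Finset ℕ) (e : AIIdentity) : Set AIIdentity :=
  {e' | ∃ F ⊆ M, e.lhs.erase F = some e'.lhs ∧ e.rhs.erase F = some e'.rhs}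

namespace BasisS412

abbrev x₁ : AITerm := .var 1
abbrev x₂ : AITerm := .var 2
abbrev x₃ : AITerm := .var 3
abbrev x₄ : AITerm := .var 4
abbrev x₅ : AITerm := .var 5
abbrev y₁ : AITerm := .var 6
abbrev y₂ : AITerm := .var 7
abbrev y₃ : AITerm := .var 8
abbrev x : AITerm := .var 9
abbrev y : AITerm := .var 10
abbrev z : AITerm := .var 11

/-- The identities in which no variable may be empty. -/
def plain : Set AIIdentity :=
  { x * x ≐ x * x * x * x,
    x * x * y * y ≐ x * y * (x * y),
    x * x * y * y ≐ y * y * x * x,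
    x * x ≐ x * x + x,
    x * x * y * y ≐ x * x * y * y + x * x,
    x + y * x ≐ y * y * x,
    x + x * y ≐ x * y * y,
    x + y * y ≐ x + y * y + y * y * x * x,
    x * y * y + z ≐ x * y * y + z * y,
    x * x * y + z ≐ x * x * y + x * z,
    x₁ * x₂ + y₁ * y₂ ≐ x₁ * x₂ + y₁ * y₂ + x₁ * y₂,
    x₁ * x₂ + x₃ * x₂ * x₄ ≐ x₁ * x₂ + x₃ * x₂ * x₄ + x₁,
    x₁ * x₂ + x₃ * x₁ * x₄ ≐ x₁ * x₂ + x₃ * x₁ * x₄ + x₂,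
    x₁ * x₂ + x₃ * x₂ * x₄ + x₅ ≐ x₁ * x₂ + x₃ * x₂ * x₄ + x₅ * x₂,
    x₁ * x₂ + x₃ * x₁ * x₄ + x₅ ≐ x₁ * x₂ + x₃ * x₁ * x₄ + x₁ * x₅ }

/-- The twenty identities, five of them with variables that may be empty. -/
def basis : Set AIIdentity :=
  plain
    -- `x₂`, `x₃` may be empty
    ∪ maybeEmpty {2, 3}
      (x₁ * x₁ * x₂ + x₃ * x₄ * x₄ ≐ x₁ * x₁ * x₂ * x₂ * x₃ * x₃ * x₄ * x₄)
    -- `x₁`, `y₁` may be empty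
    ∪ maybeEmpty {1, 6}
      (x₁ * x₂ + y₁ * x₂ * y₂ ≐ x₁ * x₂ + y₁ * x₂ * y₂ + x₁ * x₂ * y₂ * y₂)
    -- `x₂`, `y₂` may be empty
    ∪ maybeEmpty {2, 7}
      (x₁ * x₂ + y₁ * x₁ * y₂ ≐ x₁ * x₂ + y₁ * x₁ * y₂ + y₁ * y₁ * x₁ * x₂)
    -- `x₂`, `y₁`, `y₂`, `y₃` may be empty
    ∪ maybeEmpty {2, 6, 7, 8}
      (x₁ * x₂ + y₁ * x₁ * y₂ * x₁ * y₃ ≐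
        x₁ * x₂ + y₁ * x₁ * y₂ * x₁ * y₃ + x₁ * x₁ * x₂)
    -- `x₁`, `y₁`, `y₂`, `y₃` may be empty
    ∪ maybeEmpty {1, 6, 7, 8}
      (x₁ * x₂ + y₁ * x₂ * y₂ * x₂ * y₃ ≐
        x₁ * x₂ + y₁ * x₂ * y₂ * x₂ * y₃ + x₁ * x₂ * x₂)

end BasisS412

/-!
A term expands into a sum of words. In `S412` the elements `2`, `3`, `4` are minimal, so a sum takes
one of these values exactly when all its words do; and a word takes the value `4` when all its
letters do, the value `2` when its first letter does and the others have the value `4`, the value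
`3` when its last letter does and the others have the value `4`. Hence a word `q` lies below the sum
of a set `W` of words, under all assignments, exactly when the letters of `q` occur in `W` and, if
no first letter of a word in `W` also occurs in another position (`HeadSeparated`), then `q` starts
with a first letter of `W` and its other letters are not first letters of `W`, and dually for last
letters (`LastSeparated`). That `q` has these properties is
`S412.mem_content_of_satisfies`, `S412.head_of_satisfies` and `S412.last_of_satisfies`.

Conversely these properties imply in every model `A` of the basis that `q` lies below the sum of `W`
(`BasisS412.wordIn_of_criterion`). The argument takes place in the set `D` of all elements below
that sum. It is an additive ideal: a sum is in `D` if and only if both summands are. Under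
multiplication by a fixed element the preimage of an additive ideal is again one, which gives the
expansion into words (`AITerm.eval_mem_iff`). There are four cases.

* If `W` is separated on both sides, then `q` is assembled from words of `W` by exchanging suffixes.
* If `W` is not separated on the right, then `D` has an element of the form `x * y * y`
  (`BasisS412.rightSq_nonempty`). From this it follows that any letter with an occurrence in `W`
  behind a first letter may be appended to, or deleted from, the right end of a word in `D`.
* If `W` is not separated on the left, the dual argument applies.
* If `W` is separated on neither side, then `D` is closed under squares (`BasisS412.sq_mem_of_mem`)
  and contains every word in the letters of `W`.

So the models of the basis satisfy all identities of `S412`. Birkhoff's theorem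
(`inVariety_of_satisfies`) turns this into the description of the variety, and the completeness of
equational logic (`derivable_of_models`) into the existence of a finite basis.
-/

/-! ### Evaluation, substitution and homomorphisms -/

namespace AITerm

variable {A : Type u} [AISemiring A]

@[simp] theorem eval_var (φ : ℕ → A) (n : ℕ) : (var n).eval φ = φ n := rfl

@[simp] theorem eval_add (φ : ℕ → A) (s t : AITerm) :
    (s + t).eval φ = s.eval φ + t.eval φ := rfl

@[simp] theorem eval_mul (φ : ℕ → A) (s t : AITerm) :
    (s * t).eval φ = s.eval φ * t.eval φ := rfl

theorem eval_subst (φ : ℕ → A) (σ : ℕ → AITerm) (t : AITerm) :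
    (t.subst σ).eval φ = t.eval fun n => (σ n).eval φ := by
  induction t with
  | var n => rfl
  | add s t hs ht => exact congrArg₂ (· + ·) hs ht
  | mul s t hs ht => exact congrArg₂ (· * ·) hs ht

theorem subst_var (t : AITerm) : t.subst var = t := by
  induction t with
  | var n => rfl
  | add s t hs ht => exact congrArg₂ add hs ht
  | mul s t hs ht => exact congrArg₂ mul hs ht

end AITerm

theorem IsAIHom.map_eval {A : Type u} {B : Type v} [AISemiring A] [AISemiring B] {f : A → B}
    (hf : IsAIHom f) (φ : ℕ → A) (t : AITerm) : f (t.eval φ) = t.eval fun n => f (φ n) := by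
  induction t with
  | var n => rfl
  | add s t hs ht => exact (hf.map_add _ _).trans (congrArg₂ (· + ·) hs ht)
  | mul s t hs ht => exact (hf.map_mul _ _).trans (congrArg₂ (· * ·) hs ht)

theorem AISemiring.isAIHom_apply {I : Type v} {S : Type u} [AISemiring S] (i : I) :
    IsAIHom fun f : I → S => f i := ⟨fun _ _ => rfl, fun _ _ => rfl⟩

theorem AISemiring.eval_apply {I : Type v} {S : Type u} [AISemiring S] (t : AITerm)
    (φ : ℕ → I → S) (i : I) : t.eval φ i = t.eval fun n => φ n i :=
  (AISemiring.isAIHom_apply i).map_eval φ t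

theorem InVariety.satisfies {S : Type v} [AISemiring S] {A : Type u} [AISemiring A]
    (h : InVariety S A) {e : AIIdentity} (he : Satisfies S e) : Satisfies A e := by
  obtain ⟨I, B, _, ε, f, hε, hinj, hf, hsurj⟩ := h
  intro φ
  choose ψ hψ using fun n => hsurj (φ n)
  obtain rfl : (fun n => f (ψ n)) = φ := funext hψ
  rw [← hf.map_eval, ← hf.map_eval]
  congr 1
  apply hinj
  funext i
  rw [hε.map_eval, hε.map_eval, AISemiring.eval_apply, AISemiring.eval_apply]
  exact he _

/-! ### Birkhoff's theorem and the completeness of equational logic -/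

/-- The pairs `(f, a)` that arise from one term in variables indexed by the elements of `A`: its
term function `f` on `S` and its value `a` in `A`. As `AITerm` has variables in `ℕ` only, such a
term is given by an `AITerm` and a sequence `ψ` in `A`. -/
def termGraph (S : Type v) [AISemiring S] (A : Type u) [AISemiring A] :
    Set (((A → S) → S) × A) :=
  {p | ∃ (t : AITerm) (ψ : ℕ → A), p.1 = (fun χ => t.eval fun n => χ (ψ n)) ∧ p.2 = t.eval ψ}

/-- Two terms evaluated at two sequences can be brought to a common sequence, by interleaving. -/
theorem exists_common_sequence {A : Type u} [AISemiring A] (s t : AITerm) (ψ₁ ψ₂ : ℕ → A) :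
    ∃ (s' t' : AITerm) (ψ : ℕ → A), s.eval ψ₁ = s'.eval ψ ∧ t.eval ψ₂ = t'.eval ψ ∧
      ∀ {S : Type v} [AISemiring S] (χ : A → S),
        (s.eval fun n => χ (ψ₁ n)) = (s'.eval fun n => χ (ψ n)) ∧
        (t.eval fun n => χ (ψ₂ n)) = t'.eval fun n => χ (ψ n) := by
  refine ⟨s.subst fun n => .var (2 * n), t.subst fun n => .var (2 * n + 1),
    fun n => if n % 2 = 0 then ψ₁ (n / 2) else ψ₂ (n / 2), ?_⟩
  have h (n : ℕ) : (2 * n + 1) / 2 = n := by omega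
  simp [AITerm.eval_subst, h]

section

variable {S : Type v} [AISemiring S] {A : Type u} [AISemiring A]

theorem termGraph_add {p q : ((A → S) → S) × A} (hp : p ∈ termGraph S A)
    (hq : q ∈ termGraph S A) : (p.1 + q.1, p.2 + q.2) ∈ termGraph S A := by
  obtain ⟨s, ψ₁, hs₁, hs₂⟩ := hp
  obtain ⟨t, ψ₂, ht₁, ht₂⟩ := hq
  obtain ⟨s', t', ψ, h₁, h₂, h⟩ := exists_common_sequence.{u, v} s t ψ₁ ψ₂
  refine ⟨s' + t', ψ, ?_, ?_⟩
  · funext χ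
    simp only [hs₁, ht₁]
    exact congrArg₂ (· + ·) (h χ).1 (h χ).2
  · simp only [hs₂, ht₂, h₁, h₂, AITerm.eval_add]

theorem termGraph_mul {p q : ((A → S) → S) × A} (hp : p ∈ termGraph S A)
    (hq : q ∈ termGraph S A) : (p.1 * q.1, p.2 * q.2) ∈ termGraph S A := by
  obtain ⟨s, ψ₁, hs₁, hs₂⟩ := hp
  obtain ⟨t, ψ₂, ht₁, ht₂⟩ := hq
  obtain ⟨s', t', ψ, h₁, h₂, h⟩ := exists_common_sequence.{u, v} s t ψ₁ ψ₂
  refine ⟨s' * t', ψ, ?_, ?_⟩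
  · funext χ
    simp only [hs₁, ht₁]
    exact congrArg₂ (· * ·) (h χ).1 (h χ).2
  · simp only [hs₂, ht₂, h₁, h₂, AITerm.eval_mul]

/-- If `A` satisfies the identities of `S`, then `termGraph S A` is the graph of a function. -/
theorem termGraph_functional (h : ∀ e, Satisfies S e → Satisfies A e)
    {p q : ((A → S) → S) × A} (hp : p ∈ termGraph S A) (hq : q ∈ termGraph S A)
    (hpq : p.1 = q.1) : p.2 = q.2 := by
  obtain ⟨s, ψ₁, hs₁, hs₂⟩ := hp
  obtain ⟨t, ψ₂, ht₁, ht₂⟩ := hq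
  obtain ⟨s', t', ψ, h₁, h₂, h₃⟩ := exists_common_sequence.{u, v} s t ψ₁ ψ₂
  have : Nonempty A := ⟨ψ 0⟩
  -- Variables at which `ψ` takes the same value have to be identified: an assignment of
  -- elements of `S` to the identified variables then factors through `ψ`.
  let ρ : ℕ → ℕ := fun n => Function.invFun ψ (ψ n)
  have hρ (n : ℕ) : ψ (ρ n) = ψ n := Function.invFun_eq ⟨n, rfl⟩
  have key : Satisfies S (s'.subst (fun n => .var (ρ n)) ≐ t'.subst fun n => .var (ρ n)) := by
    intro χ
    simp only [AITerm.eval_subst, AITerm.eval_var]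
    have := congrFun hpq fun a => χ (Function.invFun ψ a)
    simp only [hs₁, ht₁] at this
    have h₃ := h₃ fun a => χ (Function.invFun ψ a)
    exact h₃.1.symm.trans (this.trans h₃.2)
  have := h _ key ψ
  simp only [AITerm.eval_subst, AITerm.eval_var, hρ] at this
  rw [hs₂, ht₂, h₁, h₂, this]

variable (S A) in
/-- The ai-semiring structure on `termGraph S A`, a subalgebra of `((A → S) → S) × A`. -/
abbrev termGraphAISemiring : AISemiring (termGraph S A) where
  add p q := ⟨(p.1.1 + q.1.1, p.1.2 + q.1.2), termGraph_add p.2 q.2⟩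
  mul p q := ⟨(p.1.1 * q.1.1, p.1.2 * q.1.2), termGraph_mul p.2 q.2⟩
  add_assoc _ _ _ := Subtype.ext (Prod.ext (add_assoc _ _ _) (add_assoc _ _ _))
  add_comm _ _ := Subtype.ext (Prod.ext (add_comm _ _) (add_comm _ _))
  mul_assoc _ _ _ := Subtype.ext (Prod.ext (mul_assoc _ _ _) (mul_assoc _ _ _))
  left_distrib _ _ _ := Subtype.ext (Prod.ext (mul_add _ _ _) (mul_add _ _ _))
  right_distrib _ _ _ := Subtype.ext (Prod.ext (add_mul _ _ _) (add_mul _ _ _))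
  add_idem _ := Subtype.ext (Prod.ext (AISemiring.add_idem _) (AISemiring.add_idem _))

/-- Birkhoff's theorem: the identities of `S` define the variety that `S` generates. -/
theorem inVariety_of_satisfies {S : Type} [AISemiring S]
    (h : ∀ e, Satisfies S e → Satisfies A e) : InVariety S A := by
  let _ := termGraphAISemiring S A
  refine ⟨A → S, termGraph S A, termGraphAISemiring S A, fun p => p.1.1, fun p => p.1.2,
    .mk (fun _ _ => rfl) fun _ _ => rfl, ?_, .mk (fun _ _ => rfl) fun _ _ => rfl, ?_⟩
  · intro p q hpq
    exact Subtype.ext (Prod.ext hpq (termGraph_functional h p.2 q.2 hpq))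
  · intro a
    exact ⟨⟨(fun χ => χ a, a), .var 0, fun _ => a, rfl, rfl⟩, rfl⟩

end

/-- Derivability from `E` as a congruence on terms. -/
def derivableSetoid (E : Set AIIdentity) : Setoid AITerm :=
  ⟨Derivable E, Derivable.refl, Derivable.symm, Derivable.trans⟩

/-- The free ai-semiring, on countably many generators, among those satisfying `E`. -/
instance (E : Set AIIdentity) : AISemiring (Quotient (derivableSetoid E)) where
  add := Quotient.map₂ (· + ·) fun _ _ hs _ _ ht => Derivable.add_congr hs ht
  mul := Quotient.map₂ (· * ·) fun _ _ hs _ _ ht => Derivable.mul_congr hs ht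
  add_assoc := by rintro ⟨r⟩ ⟨s⟩ ⟨t⟩; exact Quotient.sound (.add_assoc r s t)
  add_comm := by rintro ⟨s⟩ ⟨t⟩; exact Quotient.sound (.add_comm s t)
  mul_assoc := by rintro ⟨r⟩ ⟨s⟩ ⟨t⟩; exact Quotient.sound (.mul_assoc r s t)
  left_distrib := by rintro ⟨r⟩ ⟨s⟩ ⟨t⟩; exact Quotient.sound (.left_distrib r s t)
  right_distrib := by rintro ⟨r⟩ ⟨s⟩ ⟨t⟩; exact Quotient.sound (.right_distrib r s t)
  add_idem := by rintro ⟨s⟩; exact Quotient.sound (.add_idem s)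

theorem eval_quotient (E : Set AIIdentity) (σ : ℕ → AITerm) (t : AITerm) :
    t.eval (fun n => (⟦σ n⟧ : Quotient (derivableSetoid E))) = ⟦t.subst σ⟧ := by
  induction t with
  | var n => rfl
  | add s t hs ht => exact congrArg₂ (· + ·) hs ht
  | mul s t hs ht => exact congrArg₂ (· * ·) hs ht

theorem satisfies_quotient {E : Set AIIdentity} {e : AIIdentity} (he : e ∈ E) :
    Satisfies (Quotient (derivableSetoid E)) e := by
  intro φ
  choose σ hσ using fun n => Quotient.exists_rep (φ n)
  obtain rfl : (fun n => ⟦σ n⟧) = φ := funext hσ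
  rw [eval_quotient, eval_quotient]
  exact Quotient.sound (.instance_of he σ)

/-- Completeness of equational logic. -/
theorem derivable_of_models {E : Set AIIdentity} {e : AIIdentity}
    (h : ∀ (A : Type) [AISemiring A], (∀ e' ∈ E, Satisfies A e') → Satisfies A e) :
    Derivable E e.lhs e.rhs := by
  have := h (Quotient (derivableSetoid E)) (fun e' => satisfies_quotient) fun n => ⟦.var n⟧
  rw [eval_quotient, eval_quotient, AITerm.subst_var, AITerm.subst_var] at this
  exact Quotient.exact this

/-! ### Identities with variables that may be empty -/

/-- Addition on `WithOne A`, where `1` stands for the empty word; the sum has the value `1`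
when a summand is empty, in accordance with `AITerm.erase`. -/
def addWithOne {A : Type u} [AISemiring A] : WithOne A → WithOne A → WithOne A
  | some a, some b => some (a + b)
  | _, _ => none

namespace AITerm

variable {A : Type u} [AISemiring A]

/-- The value of a term under an assignment that makes some variables empty. -/
def evalWithOne (g : ℕ → WithOne A) : AITerm → WithOne A
  | var n => g n
  | add s t => addWithOne (s.evalWithOne g) (t.evalWithOne g)
  | mul s t => s.evalWithOne g * t.evalWithOne g

@[simp] theorem evalWithOne_var (g : ℕ → WithOne A) (n : ℕ) : (var n).evalWithOne g = g n := rfl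

@[simp] theorem evalWithOne_add (g : ℕ → WithOne A) (s t : AITerm) :
    (s + t).evalWithOne g = addWithOne (s.evalWithOne g) (t.evalWithOne g) := rfl

@[simp] theorem evalWithOne_mul (g : ℕ → WithOne A) (s t : AITerm) :
    (s * t).evalWithOne g = s.evalWithOne g * t.evalWithOne g := rfl

theorem evalWithOne_eq_erase (F : Finset ℕ) (φ : ℕ → A) (t : AITerm) :
    t.evalWithOne (fun n => if n ∈ F then 1 else WithOne.coe (φ n)) =
      (t.erase F).elim 1 fun t' => WithOne.coe (t'.eval φ) := by
  induction t with
  | var n =>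
    by_cases hn : n ∈ F <;> simp [evalWithOne, erase, hn]
  | add s t hs ht =>
    rw [evalWithOne, hs, ht, erase]
    cases s.erase F <;> cases t.erase F <;> rfl
  | mul s t hs ht =>
    rw [evalWithOne, hs, ht, erase]
    cases s.erase F <;> cases t.erase F <;> rfl

end AITerm

section

variable {A : Type u} [AISemiring A] {M : Finset ℕ} {e : AIIdentity}

theorem satisfies_of_mem_maybeEmpty
    (h : ∀ g : ℕ → WithOne A, (∀ n ∉ M, g n ≠ 1) →
      e.lhs.evalWithOne g = e.rhs.evalWithOne g) :
    ∀ e' ∈ maybeEmpty M e, Satisfies A e' := by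
  rintro e' ⟨F, hF, hl, hr⟩ φ
  have := h (fun n => if n ∈ F then 1 else WithOne.coe (φ n)) fun n hn => by
    rw [if_neg fun hn' => hn (hF hn')]
    exact WithOne.coe_ne_one
  rw [AITerm.evalWithOne_eq_erase, AITerm.evalWithOne_eq_erase, hl, hr] at this
  exact WithOne.coe_inj.1 this

/-- A model of the identities in `maybeEmpty M e` satisfies `e` under all assignments that give the
value `1` to variables in `M` only and under which both sides have a value in `A`. -/
theorem eq_of_maybeEmpty (h : ∀ e' ∈ maybeEmpty M e, Satisfies A e') (g : ℕ → WithOne A)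
    (hg : ∀ n ∉ M, g n ≠ 1) {a b : A} (ha : e.lhs.evalWithOne g = a)
    (hb : e.rhs.evalWithOne g = b) : a = b := by
  classical
  let F := M.filter (g · = 1)
  let φ := fun n => (g n).unoneD a
  have hF : F ⊆ M := Finset.filter_subset _ _
  have hgF : g = fun n => if n ∈ F then 1 else WithOne.coe (φ n) := by
    funext n
    by_cases hn : g n = 1
    · have : n ∈ M := by_contra fun h' => hg n h' hn
      simp [F, hn, this]
    · obtain ⟨b, hb⟩ := WithOne.ne_one_iff_exists.1 hn
      simp [F, φ, ← hb]
  rw [hgF, AITerm.evalWithOne_eq_erase] at ha hb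
  cases hl : e.lhs.erase F with
  | none => simp [hl] at ha
  | some l =>
    cases hr : e.rhs.erase F with
    | none => simp [hr] at hb
    | some r =>
      rw [hl, Option.elim_some, WithOne.coe_inj] at ha
      rw [hr, Option.elim_some, WithOne.coe_inj] at hb
      rw [← ha, ← hb]
      exact h ⟨l, r⟩ ⟨F, hF, hl, hr⟩ φ

/-- The number of identities is finite because the erased set of variables determines both sides. -/
theorem finite_maybeEmpty (M : Finset ℕ) (e : AIIdentity) : (maybeEmpty M e).Finite := by
  refine (M.powerset.finite_toSet.image fun F => AIIdentity.mk ((e.lhs.erase F).getD e.lhs)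
    ((e.rhs.erase F).getD e.rhs)).subset ?_
  rintro ⟨l, r⟩ ⟨F, hF, hl, hr⟩
  exact ⟨F, by simpa using hF, by simp_all⟩

end

namespace BasisS412

theorem finite_basis : basis.Finite := by
  have : plain.Finite := by simp [plain, Set.finite_insert]
  simp only [basis, Set.finite_union]
  simp [this, finite_maybeEmpty]

end BasisS412

/-! ### Soundness of the basis -/

namespace S412

instance : Fintype (WithOne S412) := inferInstanceAs (Fintype (Option S412))
instance : DecidableEq (WithOne S412) := inferInstanceAs (DecidableEq (Option S412))

theorem satisfies_plain : ∀ e ∈ BasisS412.plain, Satisfies S412 e := by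
  intro e he φ
  simp only [BasisS412.plain, Set.mem_insert_iff, Set.mem_singleton_iff] at he
  rcases he with rfl | rfl | rfl | rfl | rfl | rfl | rfl | rfl | rfl | rfl | rfl | rfl | rfl |
    rfl | rfl <;> simp only [AITerm.eval_var, AITerm.eval_add, AITerm.eval_mul] <;>
    generalize φ 1 = x₁, φ 2 = x₂, φ 3 = x₃, φ 4 = x₄, φ 5 = x₅, φ 6 = y₁, φ 7 = y₂,
      φ 9 = x, φ 10 = y, φ 11 = z <;>
    clear φ
  · revert x; decide +kernel
  iterate 7 revert x y; decide +kernel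
  iterate 2 revert x y z; decide +kernel
  · revert x₁ x₂ y₁ y₂; decide +kernel
  iterate 2 revert x₁ x₂ x₃ x₄; decide +kernel
  iterate 2 revert x₁ x₂ x₃ x₄ x₅; decide +kernel

theorem satisfies_basis : ∀ e ∈ BasisS412.basis, Satisfies S412 e := by
  have coe (g : ℕ → WithOne S412) (n : ℕ) (h : g n ≠ 1) : ∃ a : S412, g n = a :=
    (WithOne.ne_one_iff_exists.1 h).imp fun _ => Eq.symm
  intro e he
  simp only [BasisS412.basis, Set.mem_union] at he
  rcases he with ((((he | he) | he) | he) | he) | he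
  · exact satisfies_plain e he
  all_goals refine satisfies_of_mem_maybeEmpty (fun g hg => ?_) e he
  · change addWithOne (g 1 * g 1 * g 2) (g 3 * g 4 * g 4) =
      g 1 * g 1 * g 2 * g 2 * g 3 * g 3 * g 4 * g 4
    obtain ⟨a, ha⟩ := coe g 1 (hg 1 (by decide))
    obtain ⟨b, hb⟩ := coe g 4 (hg 4 (by decide))
    rw [ha, hb]
    generalize g 2 = c, g 3 = d
    clear he ha hb hg coe g
    revert a b c d
    decide +kernel
  · change addWithOne (g 1 * g 2) (g 6 * g 2 * g 7) =
      addWithOne (addWithOne (g 1 * g 2) (g 6 * g 2 * g 7)) (g 1 * g 2 * g 7 * g 7)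
    obtain ⟨a, ha⟩ := coe g 2 (hg 2 (by decide))
    obtain ⟨b, hb⟩ := coe g 7 (hg 7 (by decide))
    rw [ha, hb]
    generalize g 1 = c, g 6 = d
    clear he ha hb hg coe g
    revert a b c d
    decide +kernel
  · change addWithOne (g 1 * g 2) (g 6 * g 1 * g 7) =
      addWithOne (addWithOne (g 1 * g 2) (g 6 * g 1 * g 7)) (g 6 * g 6 * g 1 * g 2)
    obtain ⟨a, ha⟩ := coe g 1 (hg 1 (by decide))
    obtain ⟨b, hb⟩ := coe g 6 (hg 6 (by decide))
    rw [ha, hb]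
    generalize g 2 = c, g 7 = d
    clear he ha hb hg coe g
    revert a b c d
    decide +kernel
  · change addWithOne (g 1 * g 2) (g 6 * g 1 * g 7 * g 1 * g 8) =
      addWithOne (addWithOne (g 1 * g 2) (g 6 * g 1 * g 7 * g 1 * g 8)) (g 1 * g 1 * g 2)
    obtain ⟨a, ha⟩ := coe g 1 (hg 1 (by decide))
    rw [ha]
    generalize g 2 = b, g 6 = c, g 7 = d, g 8 = f
    clear he ha hg coe g
    revert a b c d f
    decide +kernel
  · change addWithOne (g 1 * g 2) (g 6 * g 2 * g 7 * g 2 * g 8) =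
      addWithOne (addWithOne (g 1 * g 2) (g 6 * g 2 * g 7 * g 2 * g 8)) (g 1 * g 2 * g 2)
    obtain ⟨a, ha⟩ := coe g 2 (hg 2 (by decide))
    rw [ha]
    generalize g 1 = b, g 6 = c, g 7 = d, g 8 = f
    clear he ha hg coe g
    revert a b c d f
    decide +kernel

end S412

/-! ### Words and additive ideals -/

namespace AITerm

/-- The words whose sum is the expansion of a term. -/
def words : AITerm → Set (List ℕ)
  | var n => {[n]}
  | add s t => s.words ∪ t.words
  | mul s t => Set.image2 (· ++ ·) s.words t.words

theorem ne_nil_of_mem_words {t : AITerm} : ∀ {w : List ℕ}, w ∈ t.words → w ≠ [] := by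
  induction t with
  | var n => rintro _ rfl; simp
  | add s t hs ht => rintro w (hw | hw); exacts [hs hw, ht hw]
  | mul s t hs ht => rintro _ ⟨v, hv, w, hw, rfl⟩; simp [hs hv]

end AITerm

section

variable {A : Type u} [AISemiring A]

/-- The value of a word; the empty word has the value `1`. -/
def wordVal (φ : ℕ → A) (l : List ℕ) : WithOne A := (l.map fun n => WithOne.coe (φ n)).prod

@[simp] theorem wordVal_nil (φ : ℕ → A) : wordVal φ [] = 1 := rfl

@[simp] theorem wordVal_cons (φ : ℕ → A) (n : ℕ) (l : List ℕ) :
    wordVal φ (n :: l) = φ n * wordVal φ l := by simp [wordVal]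

@[simp] theorem wordVal_append (φ : ℕ → A) (l m : List ℕ) :
    wordVal φ (l ++ m) = wordVal φ l * wordVal φ m := by simp [wordVal]

theorem exists_wordVal (φ : ℕ → A) {l : List ℕ} (hl : l ≠ []) :
    ∃ a : A, wordVal φ l = a := by
  obtain ⟨n, l, rfl⟩ := List.exists_cons_of_ne_nil hl
  induction l generalizing n with
  | nil => exact ⟨φ n, by simp⟩
  | cons m l ih =>
    obtain ⟨a, ha⟩ := ih m (by simp)
    exact ⟨φ n * a, by rw [wordVal_cons, ha, WithOne.coe_mul]⟩

/-- A set that contains a sum exactly when it contains both summands, such as the set of all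
elements below a given one. -/
def IsAddIdeal (D : Set A) : Prop := ∀ a b : A, a + b ∈ D ↔ a ∈ D ∧ b ∈ D

/-- The word `l` takes, under `φ`, a value in `D`. -/
def WordIn (D : Set A) (φ : ℕ → A) (l : List ℕ) : Prop := ∃ a ∈ D, wordVal φ l = a

theorem wordIn_iff {D : Set A} {φ : ℕ → A} {l : List ℕ} {a : A} (h : wordVal φ l = a) :
    WordIn D φ l ↔ a ∈ D := by
  simp [WordIn, h]

theorem isAddIdeal_below (p : A) : IsAddIdeal {a : A | p + a = p} := by
  intro a b
  constructor
  · intro (h : p + (a + b) = p)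
    constructor
    · change p + a = p
      rw [← h, add_assoc p, add_right_comm a, AISemiring.add_idem]
    · change p + b = p
      rw [← h, add_assoc p, add_assoc a, AISemiring.add_idem]
  · rintro ⟨ha : p + a = p, hb : p + b = p⟩
    change p + (a + b) = p
    rw [← add_assoc, ha, hb]

/-- The preimage of an additive ideal under a multiplication is again one; this makes the expansion
of a product into words available. -/
theorem AITerm.eval_mem_iff {D : Set A} (hD : IsAddIdeal D) (φ : ℕ → A) (t : AITerm) :
    t.eval φ ∈ D ↔ ∀ w ∈ t.words, WordIn D φ w := by
  induction t generalizing D with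
  | var n => simp [AITerm.words, AITerm.eval, WordIn]
  | add s t hs ht =>
    change s.eval φ + t.eval φ ∈ D ↔ _
    rw [hD, hs hD, ht hD]
    simp [AITerm.words, or_imp, forall_and]
  | mul s t hs ht =>
    have hs := hs (D := {a | a * t.eval φ ∈ D}) fun a b => by
      simp only [Set.mem_ofPred_eq, add_mul]; exact hD _ _
    change s.eval φ * t.eval φ ∈ D ↔ ∀ w ∈ Set.image2 (· ++ ·) s.words t.words, _
    rw [Set.forall_mem_image2]
    refine hs.trans (forall₂_congr fun v hv => ?_)
    obtain ⟨a, ha⟩ := exists_wordVal φ (ne_nil_of_mem_words hv)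
    have ht := ht (D := {b | a * b ∈ D}) fun b c => by
      simp only [Set.mem_ofPred_eq, mul_add]; exact hD _ _
    rw [wordIn_iff ha]
    refine ht.trans (forall₂_congr fun w hw => ?_)
    obtain ⟨b, hb⟩ := exists_wordVal φ (ne_nil_of_mem_words hw)
    rw [wordIn_iff hb, wordIn_iff (a := a * b) (by rw [wordVal_append, ha, hb, WithOne.coe_mul])]
    rfl

theorem IsAddIdeal.mem_of_eq {D : Set A} (hD : IsAddIdeal D) {a b c : A}
    (h : a + b = a + b + c) (ha : a ∈ D) (hb : b ∈ D) : c ∈ D := by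
  have := (hD a b).2 ⟨ha, hb⟩
  rw [h, hD] at this
  exact this.2

theorem IsAddIdeal.mem_of_eq_left {D : Set A} (hD : IsAddIdeal D) {a b c : A}
    (h : a + b = a + c) (ha : a ∈ D) (hb : b ∈ D) : c ∈ D := by
  have := (hD a b).2 ⟨ha, hb⟩
  rw [h, hD] at this
  exact this.2

end

/-! ### The identities of `S412` -/

/-- The first letters of the words in `W`. -/
def heads (W : Set (List ℕ)) : Set ℕ := {h | ∃ l, h :: l ∈ W}

/-- The last letters of the words in `W`. -/
def lasts (W : Set (List ℕ)) : Set ℕ := {t | ∃ l, l ++ [t] ∈ W}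

/-- No first letter of a word in `W` has an occurrence in `W` that is not a first letter. -/
def HeadSeparated (W : Set (List ℕ)) : Prop := ∀ h ∈ heads W, ∀ a l, a :: l ∈ W → h ∉ l

/-- No last letter of a word in `W` has an occurrence in `W` that is not a last letter. -/
def LastSeparated (W : Set (List ℕ)) : Prop := ∀ t ∈ lasts W, ∀ a l, l ++ [a] ∈ W → t ∉ l

namespace S412

/-- The minimal elements form additive ideals on their own. -/
theorem isAddIdeal_singleton : ∀ {c : S412}, c ≠ e1 → IsAddIdeal {c} := by
  simp only [IsAddIdeal, Set.mem_singleton_iff]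
  decide

theorem mul_eq_e4 : ∀ a b : S412, a * b = e4 ↔ a = e4 ∧ b = e4 := by decide

theorem mul_eq_e2 : ∀ a b : S412, a * b = e2 ↔ a = e2 ∧ b = e4 := by decide

theorem mul_eq_e3 : ∀ a b : S412, a * b = e3 ↔ a = e4 ∧ b = e3 := by decide

variable (χ : ℕ → S412)

theorem coe_mul_wordVal_eq {c : S412} (hc : ∀ a b : S412, a * b = c ↔ a = c ∧ b = e4)
    (x : S412) (l : List ℕ) :
    (x : WithOne S412) * wordVal χ l = c ↔ x = c ∧ ∀ n ∈ l, χ n = e4 := by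
  induction l generalizing x with
  | nil => simp
  | cons n l ih =>
    rw [wordVal_cons, ← mul_assoc, ← WithOne.coe_mul, ih, hc]
    simp [and_assoc]

theorem wordVal_mul_coe_eq_e3 (x : S412) (l : List ℕ) :
    wordVal χ l * (x : WithOne S412) = e3 ↔ x = e3 ∧ ∀ n ∈ l, χ n = e4 := by
  induction l using List.reverseRecOn generalizing x with
  | nil => simp
  | append_singleton l n ih =>
    rw [wordVal_append, mul_assoc, wordVal_cons, wordVal_nil, mul_one, ← WithOne.coe_mul, ih,
      mul_eq_e3]
    simp only [List.mem_append, List.mem_singleton, or_imp, forall_and, forall_eq]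
    tauto

theorem wordIn_e4 {l : List ℕ} (hl : l ≠ []) : WordIn {e4} χ l ↔ ∀ n ∈ l, χ n = e4 := by
  obtain ⟨n, l, rfl⟩ := List.exists_cons_of_ne_nil hl
  simp [WordIn, coe_mul_wordVal_eq χ mul_eq_e4]

theorem wordIn_e2 (h : ℕ) (l : List ℕ) :
    WordIn {e2} χ (h :: l) ↔ χ h = e2 ∧ ∀ n ∈ l, χ n = e4 := by
  simp [WordIn, coe_mul_wordVal_eq χ mul_eq_e2]

theorem wordIn_e3 (t : ℕ) (l : List ℕ) :
    WordIn {e3} χ (l ++ [t]) ↔ χ t = e3 ∧ ∀ n ∈ l, χ n = e4 := by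
  simp [WordIn, wordVal_mul_coe_eq_e3]

/-- If `s ≈ t` holds in `S412` and all words of `s` take the same minimal value, then so do those
of `t`. -/
theorem wordIn_of_satisfies {s t : AITerm} (h : Satisfies S412 (s ≐ t)) {c : S412}
    (hc : c ≠ e1) (hs : ∀ w ∈ s.words, WordIn {c} χ w) : ∀ w ∈ t.words, WordIn {c} χ w := by
  rw [← AITerm.eval_mem_iff (isAddIdeal_singleton hc)] at hs ⊢
  rw [← h χ]
  exact hs

open Classical in
theorem mem_content_of_satisfies {s t : AITerm} (h : Satisfies S412 (s ≐ t)) {q : List ℕ}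
    (hq : q ∈ t.words) {n : ℕ} (hn : n ∈ q) : ∃ w ∈ s.words, n ∈ w := by
  have := wordIn_of_satisfies (fun n => if ∃ w ∈ s.words, n ∈ w then e4 else e1) h
    (c := e4) (by decide) (fun w hw => (wordIn_e4 _ (AITerm.ne_nil_of_mem_words hw)).2
      fun n hn => if_pos ⟨w, hw, hn⟩) q hq
  rw [wordIn_e4 _ (AITerm.ne_nil_of_mem_words hq)] at this
  by_contra hn'
  simpa [hn'] using this n hn

open Classical in
theorem head_of_satisfies {s t : AITerm} (h : Satisfies S412 (s ≐ t))
    (hs : HeadSeparated s.words) {a : ℕ} {l : List ℕ} (hq : a :: l ∈ t.words) :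
    a ∈ heads s.words ∧ ∀ n ∈ l, n ∉ heads s.words := by
  have := wordIn_of_satisfies (fun n => if n ∈ heads s.words then e2 else e4) h
    (c := e2) (by decide) (fun w hw => by
      obtain ⟨b, m, rfl⟩ := List.exists_cons_of_ne_nil (AITerm.ne_nil_of_mem_words hw)
      rw [wordIn_e2]
      exact ⟨if_pos ⟨m, hw⟩, fun n hn => if_neg fun hn' => hs n hn' b m hw hn⟩) _ hq
  rw [wordIn_e2] at this
  simpa using this

open Classical in
theorem last_of_satisfies {s t : AITerm} (h : Satisfies S412 (s ≐ t))
    (hs : LastSeparated s.words) {a : ℕ} {l : List ℕ} (hq : l ++ [a] ∈ t.words) :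
    a ∈ lasts s.words ∧ ∀ n ∈ l, n ∉ lasts s.words := by
  have := wordIn_of_satisfies (fun n => if n ∈ lasts s.words then e3 else e4) h
    (c := e3) (by decide) (fun w hw => by
      obtain ⟨m, b, rfl⟩ := List.eq_nil_or_concat' w |>.resolve_left
        (AITerm.ne_nil_of_mem_words hw)
      rw [wordIn_e3]
      exact ⟨if_pos ⟨m, hw⟩, fun n hn => if_neg fun hn' => hs n hn' b m hw hn⟩) _ hq
  rw [wordIn_e3] at this
  simpa using this

end S412

/-! ### Consequences of the basis for additive ideals -/

namespace BasisS412

/-- The elements whose square occurs as a right factor, behind another factor, in an element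
of `D`. -/
def rightSq {A : Type u} [AISemiring A] (D : Set A) : Set A := {y | ∃ x, x * y * y ∈ D}

/-- The elements whose square occurs as a left factor, before another factor, in an element
of `D`. -/
def leftSq {A : Type u} [AISemiring A] (D : Set A) : Set A := {y | ∃ x, y * y * x ∈ D}

section

variable {A : Type u} [AISemiring A] (hA : ∀ e ∈ basis, Satisfies A e)
include hA

theorem eval_eq_of_mem_plain {e : AIIdentity} (φ : ℕ → A)
    (he : e ∈ plain := by
      simp only [plain, Set.mem_insert_iff, Set.mem_singleton_iff, true_or, or_true]) :
    e.lhs.eval φ = e.rhs.eval φ :=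
  hA e (by simp only [basis, Set.mem_union]; tauto) φ

theorem sq_mul_sq (a b : A) : a * a * b * b = a * b * (a * b) :=
  eval_eq_of_mem_plain hA (e := x * x * y * y ≐ x * y * (x * y))
    fun | 9 => a | _ => b

theorem sq_mul_sq_comm (a b : A) : a * a * b * b = b * b * a * a :=
  eval_eq_of_mem_plain hA (e := x * x * y * y ≐ y * y * x * x)
    fun | 9 => a | _ => b

theorem sq_eq_sq_add (a : A) : a * a = a * a + a :=
  eval_eq_of_mem_plain hA (e := x * x ≐ x * x + x) fun _ => a

theorem sq_mul_sq_eq_add (a b : A) : a * a * b * b = a * a * b * b + a * a :=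
  eval_eq_of_mem_plain hA (e := x * x * y * y ≐ x * x * y * y + x * x)
    fun | 9 => a | _ => b

theorem add_mul_left_eq (a b : A) : a + b * a = b * b * a :=
  eval_eq_of_mem_plain hA (e := x + y * x ≐ y * y * x)
    fun | 9 => a | _ => b

theorem add_mul_right_eq (a b : A) : a + a * b = a * b * b :=
  eval_eq_of_mem_plain hA (e := x + x * y ≐ x * y * y)
    fun | 9 => a | _ => b

theorem add_sq_eq (a b : A) : a + b * b = a + b * b + b * b * a * a :=
  eval_eq_of_mem_plain hA (e := x + y * y ≐ x + y * y + y * y * x * x)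
    fun | 9 => a | _ => b

theorem mul_sq_add_eq (a b c : A) : a * b * b + c = a * b * b + c * b :=
  eval_eq_of_mem_plain hA (e := x * y * y + z ≐ x * y * y + z * y)
    fun | 9 => a | 10 => b | _ => c

theorem sq_mul_add_eq (a b c : A) : a * a * b + c = a * a * b + a * c :=
  eval_eq_of_mem_plain hA (e := x * x * y + z ≐ x * x * y + x * z)
    fun | 9 => a | 10 => b | _ => c

theorem exchange_eq (a b c d : A) : a * b + c * d = a * b + c * d + a * d :=
  eval_eq_of_mem_plain hA (e := x₁ * x₂ + y₁ * y₂ ≐ x₁ * x₂ + y₁ * y₂ + x₁ * y₂)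
    fun | 1 => a | 2 => b | 6 => c | _ => d

theorem drop_right_eq (a b c d : A) : a * b + c * b * d = a * b + c * b * d + a :=
  eval_eq_of_mem_plain hA (e := x₁ * x₂ + x₃ * x₂ * x₄ ≐ x₁ * x₂ + x₃ * x₂ * x₄ + x₁)
    fun | 1 => a | 2 => b | 3 => c | _ => d

theorem drop_left_eq (a b c d : A) : a * b + c * a * d = a * b + c * a * d + b :=
  eval_eq_of_mem_plain hA (e := x₁ * x₂ + x₃ * x₁ * x₄ ≐ x₁ * x₂ + x₃ * x₁ * x₄ + x₂)
    fun | 1 => a | 2 => b | 3 => c | _ => d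

theorem sq_mul_add_mul_sq (a b c d : A) :
    a * a * b + c * d * d = a * a * b * b * c * c * d * d := by
  refine eq_of_maybeEmpty (M := {2, 3})
    (e := x₁ * x₁ * x₂ + x₃ * x₄ * x₄ ≐ x₁ * x₁ * x₂ * x₂ * x₃ * x₃ * x₄ * x₄)
    (fun e' he' => hA e' ?_) (fun | 1 => a | 2 => b | 3 => c | _ => d) ?_ rfl rfl
  · simp only [basis, Set.mem_union]
    tauto
  · intro n _
    split <;> exact WithOne.coe_ne_one

/-- A letter that ends a word and is followed by `b` in another one yields a square of `b`
at the end. -/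
theorem add_mul_sq_of_last (x y : WithOne A) {a b c d : A} (hc : x * a = c) (hd : y * a * b = d) :
    c + d = c + d + c * b * b := by
  refine eq_of_maybeEmpty (M := {1, 6})
    (e := x₁ * x₂ + y₁ * x₂ * y₂ ≐ x₁ * x₂ + y₁ * x₂ * y₂ + x₁ * x₂ * y₂ * y₂)
    (fun e' he' => hA e' ?_)
    (fun | 1 => x | 6 => y | 2 => a | _ => b) ?_ ?_ ?_
  · simp only [basis, Set.mem_union]
    tauto
  · intro n hn
    split
    · simp at hn
    · simp at hn
    all_goals exact WithOne.coe_ne_one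
  · simp only [AITerm.evalWithOne_add, AITerm.evalWithOne_mul, AITerm.evalWithOne_var, hc, hd]
    rfl
  · simp only [AITerm.evalWithOne_add, AITerm.evalWithOne_mul, AITerm.evalWithOne_var, hc, hd]
    rfl

/-- A letter that starts a word and is preceded by `b` in another one yields a square of `b`
at the start. -/
theorem add_sq_mul_of_head (x y : WithOne A) {a b c d : A} (hc : a * x = c) (hd : b * a * y = d) :
    c + d = c + d + b * b * c := by
  refine eq_of_maybeEmpty (M := {2, 7})
    (e := x₁ * x₂ + y₁ * x₁ * y₂ ≐ x₁ * x₂ + y₁ * x₁ * y₂ + y₁ * y₁ * x₁ * x₂)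
    (fun e' he' => hA e' ?_)
    (fun | 2 => x | 7 => y | 1 => a | _ => b) ?_ ?_ ?_
  · simp only [basis, Set.mem_union]
    tauto
  · intro n hn
    split
    · simp at hn
    · simp at hn
    all_goals exact WithOne.coe_ne_one
  · simp only [AITerm.evalWithOne_add, AITerm.evalWithOne_mul, AITerm.evalWithOne_var, hc, hd]
    rfl
  · simp only [AITerm.evalWithOne_add, AITerm.evalWithOne_mul, AITerm.evalWithOne_var, hc, hd,
      mul_assoc _ (a : WithOne A) x]
    rfl

variable {D : Set A} (hD : IsAddIdeal D)
include hD

theorem mul_sq_mem_iff (a b : A) : a * b * b ∈ D ↔ a ∈ D ∧ a * b ∈ D := by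
  rw [← add_mul_right_eq hA, hD]

theorem sq_mul_mem_iff (a b : A) : b * b * a ∈ D ↔ a ∈ D ∧ b * a ∈ D := by
  rw [← add_mul_left_eq hA, hD]

theorem mul_mem_of_rightSq {a b : A} (ha : a ∈ D) (hb : b ∈ rightSq D) : a * b ∈ D := by
  obtain ⟨c, hc⟩ := hb
  exact hD.mem_of_eq_left (mul_sq_add_eq hA c b a) hc ha

theorem mul_mem_of_leftSq {a b : A} (ha : a ∈ D) (hb : b ∈ leftSq D) : b * a ∈ D := by
  obtain ⟨c, hc⟩ := hb
  exact hD.mem_of_eq_left (sq_mul_add_eq hA b c a) hc ha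

theorem of_mul_mem_rightSq {a b : A} (h : a * b ∈ rightSq D) : a ∈ rightSq D ∧ b ∈ rightSq D := by
  obtain ⟨c, hc⟩ := h
  have h₁ : c * (a * b) * (a * b) = c * a * a * b * b := by
    rw [mul_assoc, ← sq_mul_sq hA]; simp only [mul_assoc]
  have h₂ : c * (a * b) * (a * b) = c * b * b * a * a := by
    rw [mul_assoc, ← sq_mul_sq hA, sq_mul_sq_comm hA]; simp only [mul_assoc]
  have h₁ := h₁ ▸ hc
  have h₂ := h₂ ▸ hc
  exact ⟨⟨c, ((mul_sq_mem_iff hA hD _ _).1 h₁).1⟩, ⟨c, ((mul_sq_mem_iff hA hD _ _).1 h₂).1⟩⟩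

theorem of_mul_mem_leftSq {a b : A} (h : a * b ∈ leftSq D) : a ∈ leftSq D ∧ b ∈ leftSq D := by
  obtain ⟨c, hc⟩ := h
  have h₁ : a * b * (a * b) * c = b * b * (a * a * c) := by
    rw [← sq_mul_sq hA, sq_mul_sq_comm hA]; simp only [mul_assoc]
  have h₂ : a * b * (a * b) * c = a * a * (b * b * c) := by
    rw [← sq_mul_sq hA]; simp only [mul_assoc]
  have h₁ := h₁ ▸ hc
  have h₂ := h₂ ▸ hc
  exact ⟨⟨c, ((sq_mul_mem_iff hA hD _ _).1 h₁).1⟩, ⟨c, ((sq_mul_mem_iff hA hD _ _).1 h₂).1⟩⟩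

/-- If `D` has a right square, then right factors can be deleted in `D` and may be repeated. -/
theorem mem_and_mem_rightSq (hne : (rightSq D).Nonempty) {a b : A} (h : a * b ∈ D) :
    a ∈ D ∧ b ∈ rightSq D := by
  obtain ⟨c, hc⟩ := hne
  have ha := hD.mem_of_eq (drop_right_eq hA a b a c) h (mul_mem_of_rightSq hA hD h hc)
  exact ⟨ha, a, (mul_sq_mem_iff hA hD a b).2 ⟨ha, h⟩⟩

/-- If `D` has a left square, then left factors can be deleted in `D` and may be repeated. -/
theorem mem_and_mem_leftSq (hne : (leftSq D).Nonempty) {a b : A} (h : a * b ∈ D) :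
    b ∈ D ∧ a ∈ leftSq D := by
  obtain ⟨c, hc⟩ := hne
  have h' := mul_mem_of_leftSq hA hD h hc
  rw [← mul_assoc] at h'
  have hb := hD.mem_of_eq (drop_left_eq hA a b c b) h h'
  exact ⟨hb, b, (sq_mul_mem_iff hA hD b a).2 ⟨hb, h⟩⟩

theorem sq_mem_of_sq_mul_sq {a b : A} (h : a * a * b * b ∈ D) : a * a ∈ D := by
  rw [sq_mul_sq_eq_add hA, hD] at h
  exact h.2

theorem mem_of_sq_mem {a : A} (h : a * a ∈ D) : a ∈ D := by
  rw [sq_eq_sq_add hA, hD] at h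
  exact h.2

theorem of_mul_sq_mem {a b : A} (h : a * b * (a * b) ∈ D) : a * a ∈ D ∧ b * b ∈ D := by
  rw [← sq_mul_sq hA] at h
  have h' := h
  rw [sq_mul_sq_comm hA] at h'
  exact ⟨sq_mem_of_sq_mul_sq hA hD h, sq_mem_of_sq_mul_sq hA hD h'⟩

theorem mul_sq_mem {a b : A} (ha : a * a ∈ D) (hb : b * b ∈ D) : a * b * (a * b) ∈ D := by
  rw [← sq_mul_sq hA]
  exact hD.mem_of_eq (add_sq_eq hA b a) (mem_of_sq_mem hA hD hb) ha

/-- A right square and a left square together produce a proper square in `D`, and by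
`x + y² ≈ x + y² + y²x²` this makes `D` closed under squares. -/
theorem sq_mem_of_mem (hr : (rightSq D).Nonempty) (hl : (leftSq D).Nonempty) {a : A}
    (ha : a ∈ D) : a * a ∈ D := by
  obtain ⟨c, z, hz⟩ := hr
  obtain ⟨b, y, hy⟩ := hl
  have h := (hD _ _).2 ⟨hy, hz⟩
  rw [sq_mul_add_mul_sq hA] at h
  have hb : b * b ∈ D := sq_mem_of_sq_mul_sq hA hD (b := y * (z * c)) (by
    rw [mul_assoc (b * b), ← sq_mul_sq hA, mul_assoc (y * y), ← sq_mul_sq hA]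
    simpa only [mul_assoc] using h)
  have := hD.mem_of_eq (add_sq_eq hA a b) ha hb
  rw [sq_mul_sq_comm hA] at this
  exact sq_mem_of_sq_mul_sq hA hD this

end

end BasisS412

/-! ### Completeness of the basis -/

namespace BasisS412

variable {A : Type u} [AISemiring A] (hA : ∀ e ∈ basis, Satisfies A e)
  {D : Set A} (hD : IsAddIdeal D) {φ : ℕ → A} {W : Set (List ℕ)}
include hA hD

/-- The form of `x₁x₂ + y₁y₂ ≈ x₁x₂ + y₁y₂ + x₁y₂` for words. -/
theorem wordIn_exchange {k l m n : List ℕ} (hk : k ≠ []) (hl : l ≠ []) (hm : m ≠ [])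
    (hn : n ≠ []) (h₁ : WordIn D φ (k ++ l)) (h₂ : WordIn D φ (m ++ n)) :
    WordIn D φ (k ++ n) := by
  obtain ⟨a, ha⟩ := exists_wordVal φ hk
  obtain ⟨b, hb⟩ := exists_wordVal φ hl
  obtain ⟨c, hc⟩ := exists_wordVal φ hm
  obtain ⟨d, hd⟩ := exists_wordVal φ hn
  rw [wordIn_iff (a := a * b) (by simp [ha, hb])] at h₁
  rw [wordIn_iff (a := c * d) (by simp [hc, hd])] at h₂
  rw [wordIn_iff (a := a * d) (by simp [ha, hd])]
  exact hD.mem_of_eq (exchange_eq hA a b c d) h₁ h₂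

theorem mem_rightSq_of_wordVal {l : List ℕ} {a : A} (hl : wordVal φ l = a)
    (ha : a ∈ rightSq D) : ∀ n ∈ l, φ n ∈ rightSq D := by
  induction l generalizing a with
  | nil => simp
  | cons m l ih =>
    rcases eq_or_ne l [] with rfl | hne
    · simp_all
    · obtain ⟨b, hb⟩ := exists_wordVal φ hne
      rw [wordVal_cons, hb, ← WithOne.coe_mul, WithOne.coe_inj] at hl
      obtain ⟨h₁, h₂⟩ := of_mul_mem_rightSq hA hD (hl ▸ ha)
      simpa [h₁] using ih hb h₂

theorem mem_leftSq_of_wordVal {l : List ℕ} {a : A} (hl : wordVal φ l = a)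
    (ha : a ∈ leftSq D) : ∀ n ∈ l, φ n ∈ leftSq D := by
  induction l generalizing a with
  | nil => simp
  | cons m l ih =>
    rcases eq_or_ne l [] with rfl | hne
    · simp_all
    · obtain ⟨b, hb⟩ := exists_wordVal φ hne
      rw [wordVal_cons, hb, ← WithOne.coe_mul, WithOne.coe_inj] at hl
      obtain ⟨h₁, h₂⟩ := of_mul_mem_leftSq hA hD (hl ▸ ha)
      simpa [h₁] using ih hb h₂

/-- The first letter of a word in `D` belongs to `D`, and the other letters may follow any
element of `D`. -/
theorem head_mem_of_rightSq (hne : (rightSq D).Nonempty) {h : ℕ} {l : List ℕ}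
    (hw : WordIn D φ (h :: l)) : φ h ∈ D ∧ ∀ n ∈ l, φ n ∈ rightSq D := by
  rcases eq_or_ne l [] with rfl | hl
  · simpa [WordIn] using hw
  · obtain ⟨a, ha⟩ := exists_wordVal φ hl
    rw [wordIn_iff (a := φ h * a) (by simp [ha])] at hw
    obtain ⟨h₁, h₂⟩ := mem_and_mem_rightSq hA hD hne hw
    exact ⟨h₁, mem_rightSq_of_wordVal hA hD ha h₂⟩

/-- The last letter of a word in `D` belongs to `D`, and the other letters may precede any
element of `D`. -/
theorem last_mem_of_leftSq (hne : (leftSq D).Nonempty) {t : ℕ} {l : List ℕ}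
    (hw : WordIn D φ (l ++ [t])) : φ t ∈ D ∧ ∀ n ∈ l, φ n ∈ leftSq D := by
  rcases eq_or_ne l [] with rfl | hl
  · simpa [WordIn] using hw
  · obtain ⟨a, ha⟩ := exists_wordVal φ hl
    rw [wordIn_iff (a := a * φ t) (by simp [ha])] at hw
    obtain ⟨h₁, h₂⟩ := mem_and_mem_leftSq hA hD hne hw
    exact ⟨h₁, mem_leftSq_of_wordVal hA hD ha h₂⟩

theorem wordIn_of_rightSq {h : ℕ} {l : List ℕ} (hh : φ h ∈ D) (hl : ∀ n ∈ l, φ n ∈ rightSq D) :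
    WordIn D φ (h :: l) := by
  induction l using List.reverseRecOn with
  | nil => simpa [WordIn] using hh
  | append_singleton l n ih =>
    obtain ⟨a, ha, hw⟩ := ih fun m hm => hl m (by simp [hm])
    refine ⟨a * φ n, mul_mem_of_rightSq hA hD ha (hl n (by simp)), ?_⟩
    rw [← List.cons_append, wordVal_append, hw]
    simp

theorem wordIn_of_leftSq {t : ℕ} {l : List ℕ} (ht : φ t ∈ D) (hl : ∀ n ∈ l, φ n ∈ leftSq D) :
    WordIn D φ (l ++ [t]) := by
  induction l with
  | nil => simpa [WordIn] using ht
  | cons n l ih =>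
    obtain ⟨a, ha, hw⟩ := ih fun m hm => hl m (by simp [hm])
    refine ⟨φ n * a, mul_mem_of_leftSq hA hD ha (hl n (by simp)), ?_⟩
    rw [List.cons_append, wordVal_cons, hw, WithOne.coe_mul]

/-- An occurrence of a last letter in another position produces a right square. -/
theorem rightSq_nonempty (hW : ∀ w ∈ W, WordIn D φ w) (hlast : ¬ LastSeparated W) :
    (rightSq D).Nonempty := by
  simp only [LastSeparated, not_forall, not_not] at hlast
  obtain ⟨t, ⟨m, hm⟩, n, l, hl, ht⟩ := hlast
  obtain ⟨l₁, l₂, rfl⟩ := List.append_of_mem ht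
  obtain ⟨c, hc, hc'⟩ := hW _ hm
  obtain ⟨d, hd, hd'⟩ := hW _ hl
  obtain ⟨b, hb⟩ := exists_wordVal φ (l := l₂ ++ [n]) (by simp)
  rw [List.append_assoc, List.cons_append, wordVal_append, wordVal_cons, hb, ← mul_assoc] at hd'
  rw [wordVal_append, wordVal_cons, wordVal_nil, mul_one] at hc'
  exact ⟨b, c, hD.mem_of_eq (add_mul_sq_of_last hA _ _ hc' hd') hc hd⟩

/-- An occurrence of a first letter in another position produces a left square. -/
theorem leftSq_nonempty (hW : ∀ w ∈ W, WordIn D φ w) (hhead : ¬ HeadSeparated W) :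
    (leftSq D).Nonempty := by
  simp only [HeadSeparated, not_forall, not_not] at hhead
  obtain ⟨h, ⟨m, hm⟩, n, l, hl, hh⟩ := hhead
  obtain ⟨l₁, l₂, rfl⟩ := List.append_of_mem hh
  obtain ⟨c, hc, hc'⟩ := hW _ hm
  obtain ⟨d, hd, hd'⟩ := hW _ hl
  obtain ⟨b, hb⟩ := exists_wordVal φ (l := n :: l₁) (by simp)
  rw [← List.cons_append, wordVal_append, hb, wordVal_cons, ← mul_assoc] at hd'
  rw [wordVal_cons] at hc'
  exact ⟨b, c, hD.mem_of_eq (add_sq_mul_of_head hA _ _ hc' hd') hc hd⟩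

theorem sq_mem_of_wordIn (hsq : ∀ a ∈ D, a * a ∈ D) {l : List ℕ} (hl : WordIn D φ l) :
    ∀ n ∈ l, φ n * φ n ∈ D := by
  obtain ⟨a, ha, hl⟩ := hl
  replace ha := hsq a ha
  induction l generalizing a with
  | nil => simp
  | cons m l ih =>
    rcases eq_or_ne l [] with rfl | hne
    · simp_all
    · obtain ⟨b, hb⟩ := exists_wordVal φ hne
      rw [wordVal_cons, hb, ← WithOne.coe_mul, WithOne.coe_inj] at hl
      obtain ⟨h₁, h₂⟩ := of_mul_sq_mem hA hD (hl ▸ ha)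
      simpa [h₁] using ih b hb h₂

theorem wordIn_of_sq_mem {l : List ℕ} (hl : ∀ n ∈ l, φ n * φ n ∈ D) (hne : l ≠ []) :
    WordIn D φ l := by
  obtain ⟨a, ha⟩ := exists_wordVal φ hne
  refine ⟨a, mem_of_sq_mem hA hD ?_, ha⟩
  induction l generalizing a with
  | nil => contradiction
  | cons m l ih =>
    rcases eq_or_ne l [] with rfl | hne
    · simp_all
    · obtain ⟨b, hb⟩ := exists_wordVal φ hne
      rw [wordVal_cons, hb, ← WithOne.coe_mul, WithOne.coe_inj] at ha
      rw [← ha]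
      exact mul_sq_mem hA hD (hl m (by simp)) (ih (fun n hn => hl n (by simp [hn])) hne b hb)

/-- The case in which first letters and last letters are separated: only the exchange of
suffixes is needed. -/
theorem wordIn_of_separated (hW : ∀ w ∈ W, WordIn D φ w) (hlast : LastSeparated W) {q : List ℕ}
    (hcont : ∀ n ∈ q, ∃ w ∈ W, n ∈ w)
    (hqh : ∀ a l, q = a :: l → a ∈ heads W ∧ ∀ n ∈ l, n ∉ heads W)
    (hql : ∀ a l, q = l ++ [a] → a ∈ lasts W ∧ ∀ n ∈ l, n ∉ lasts W)
    (hne : q ≠ []) : WordIn D φ q := by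
  obtain ⟨h, l, rfl⟩ := List.exists_cons_of_ne_nil hne
  obtain ⟨⟨r, hr⟩, hl⟩ := hqh h l rfl
  rcases List.eq_nil_or_concat' l with rfl | ⟨l, t, rfl⟩
  · rcases List.eq_nil_or_concat' r with rfl | ⟨r, a, rfl⟩
    · exact hW _ hr
    · exact absurd List.mem_cons_self (hlast h (hql h [] rfl).1 a (h :: r) hr)
  obtain ⟨⟨r', hr'⟩, hm⟩ := hql t (h :: l) rfl
  have hh : h ∉ lasts W := hm h (by simp)
  have ht : t ∉ heads W := hl t (by simp)
  have hr₀ : r ≠ [] := by rintro rfl; exact hh ⟨[], hr⟩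
  have hr₀' : r' ≠ [] := by rintro rfl; exact ht ⟨[], hr'⟩
  have hht : WordIn D φ ([h] ++ [t]) :=
    wordIn_exchange hA hD (l := r) (m := r') (by simp) hr₀ hr₀' (by simp) (hW _ hr) (hW _ hr')
  have key : ∀ n ∈ l, WordIn D φ ([h] ++ [n, t]) := by
    intro n hn
    have hnh : n ∉ heads W := hl n (by simp [hn])
    have hnt : n ∉ lasts W := hm n (by simp [hn])
    obtain ⟨w, hw, hnw⟩ := hcont n (by simp [hn])
    obtain ⟨a, b, rfl⟩ := List.append_of_mem hnw
    have ha : a ≠ [] := by rintro rfl; exact hnh ⟨b, hw⟩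
    have hb : b ≠ [] := by rintro rfl; exact hnt ⟨a, hw⟩
    have h₁ : WordIn D φ ([h] ++ n :: b) :=
      wordIn_exchange hA hD (l := r) (by simp) hr₀ ha (by simp) (hW _ hr) (hW _ hw)
    exact wordIn_exchange hA hD (k := [h, n]) (m := r') (by simp) hb hr₀' (by simp) h₁ (hW _ hr')
  have hkey : ∀ l', (∀ n ∈ l', n ∈ l) → WordIn D φ ((h :: l') ++ [t]) := by
    intro l' hl'
    induction l' using List.reverseRecOn with
    | nil => exact hht
    | append_singleton l' n ih =>
      have h₁ := ih fun m hm => hl' m (by simp [hm])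
      have h₂ := wordIn_exchange hA hD (n := [n, t]) (by simp) (by simp) (by simp) (by simp) h₁
        (key n (hl' n (by simp)))
      simpa using h₂
  exact hkey l fun _ => id

/-- A word that is below the sum of `W` according to `S412` is below it in every model of
the basis. -/
theorem wordIn_of_criterion (hW : ∀ w ∈ W, WordIn D φ w) {q : List ℕ}
    (hW₀ : ∀ w ∈ W, w ≠ []) (hcont : ∀ n ∈ q, ∃ w ∈ W, n ∈ w)
    (hqh : HeadSeparated W → ∀ a l, q = a :: l → a ∈ heads W ∧ ∀ n ∈ l, n ∉ heads W)
    (hql : LastSeparated W → ∀ a l, q = l ++ [a] → a ∈ lasts W ∧ ∀ n ∈ l, n ∉ lasts W)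
    (hne : q ≠ []) : WordIn D φ q := by
  by_cases hhead : HeadSeparated W <;> by_cases hlast : LastSeparated W
  · exact wordIn_of_separated hA hD hW hlast hcont (hqh hhead) (hql hlast) hne
  · have hr := rightSq_nonempty hA hD hW hlast
    obtain ⟨h, l, rfl⟩ := List.exists_cons_of_ne_nil hne
    obtain ⟨⟨r, hr'⟩, hl⟩ := hqh hhead h l rfl
    refine wordIn_of_rightSq hA hD (head_mem_of_rightSq hA hD hr (hW _ hr')).1 fun n hn => ?_
    obtain ⟨w, hw, hnw⟩ := hcont n (by simp [hn])
    obtain ⟨a, m, rfl⟩ := List.exists_cons_of_ne_nil (hW₀ w hw)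
    rcases List.mem_cons.1 hnw with rfl | hnm
    · exact absurd ⟨m, hw⟩ (hl n hn)
    · exact (head_mem_of_rightSq hA hD hr (hW _ hw)).2 n hnm
  · have hr := leftSq_nonempty hA hD hW hhead
    obtain ⟨l, t, rfl⟩ := (List.eq_nil_or_concat' q).resolve_left hne
    obtain ⟨⟨r, hr'⟩, hl⟩ := hql hlast t l rfl
    refine wordIn_of_leftSq hA hD (last_mem_of_leftSq hA hD hr (hW _ hr')).1 fun n hn => ?_
    obtain ⟨w, hw, hnw⟩ := hcont n (by simp [hn])
    obtain ⟨m, a, rfl⟩ := (List.eq_nil_or_concat' w).resolve_left (hW₀ w hw)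
    rcases List.mem_append.1 hnw with hnm | hna
    · exact (last_mem_of_leftSq hA hD hr (hW _ hw)).2 n hnm
    · obtain rfl := List.mem_singleton.1 hna
      exact absurd ⟨m, hw⟩ (hl n hn)
  · have hsq (a : A) : a ∈ D → a * a ∈ D :=
      sq_mem_of_mem hA hD (rightSq_nonempty hA hD hW hlast) (leftSq_nonempty hA hD hW hhead)
    refine wordIn_of_sq_mem hA hD (fun n hn => ?_) hne
    obtain ⟨w, hw, hnw⟩ := hcont n hn
    exact sq_mem_of_wordIn hA hD hsq (hW w hw) n hnw

omit hD in
theorem eval_add_eval_of_satisfies {s t : AITerm} (h : Satisfies S412 (s ≐ t)) (φ : ℕ → A) :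
    s.eval φ + t.eval φ = s.eval φ := by
  have hD := isAddIdeal_below (s.eval φ)
  have hs : s.eval φ ∈ {a : A | s.eval φ + a = s.eval φ} := AISemiring.add_idem _
  change t.eval φ ∈ {a : A | s.eval φ + a = s.eval φ}
  rw [AITerm.eval_mem_iff hD] at hs ⊢
  intro q hq
  refine wordIn_of_criterion hA hD hs (fun w => AITerm.ne_nil_of_mem_words)
    (fun n => S412.mem_content_of_satisfies h hq) ?_ ?_ (AITerm.ne_nil_of_mem_words hq)
  · rintro hsep a l rfl
    exact S412.head_of_satisfies h hsep hq
  · rintro hsep a l rfl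
    exact S412.last_of_satisfies h hsep hq

omit hD in
theorem satisfies_of_satisfies_S412 {e : AIIdentity} (h : Satisfies S412 e) :
    Satisfies A e := by
  intro φ
  have h₁ := eval_add_eval_of_satisfies hA (s := e.lhs) (t := e.rhs) h φ
  have h₂ := eval_add_eval_of_satisfies hA (s := e.rhs) (t := e.lhs) (fun χ => (h χ).symm) φ
  rw [← h₁, add_comm, h₂]

end BasisS412

theorem mainTheorem4 :
    (∀ (A : Type u) [AISemiring A],
      InVariety S412 A ↔ ∀ e ∈ BasisS412.basis, Satisfies A e) ∧
    FinitelyBased S412 := by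
  refine ⟨fun A _ => ⟨fun h e he => h.satisfies (S412.satisfies_basis e he), fun hA =>
    inVariety_of_satisfies fun e => BasisS412.satisfies_of_satisfies_S412 hA⟩,
    BasisS412.basis, BasisS412.finite_basis, S412.satisfies_basis, fun e he => ?_⟩
  exact derivable_of_models fun A _ hA => BasisS412.satisfies_of_satisfies_S412 hA he
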